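/- **Theorem 3.1.** *Setting.* Let $E$ be $\mathbb R^d$ with an arbitrary norm $\|\cdot\|$, let $\mathcal B_0^*$ be the set of extreme points of the unit ball of the dual norm, and let $\mathrm{VC}(\mathcal B_0^*)$ be the VC dimension of the class of half-spaces $\{x\in E:\langle x,v\rangle\ge 0\}$, $v\in\mathcal B_0^*$. Let $Y_1,\dots,Y_N$ be i.i.d. random vectors in $E$ with finite second moment, $\mu=\mathbb E Y_1$, and $R\ge 0$ with $R^2=\sup_{v\in\mathcal B_0^*}\mathbb E\langle Y_1-\mu,v\rangle^2$. One observes $X_1,\dots,X_N$ such that $X_i=Y_i$ for all $i\notin\mathcal O$, where $\mathcal O\subseteq\{1,\dots,N\}$ is a random set; $\mathcal O$ and the $X_i$, $i\in\mathcal O$, may depend on $Y_1,\dots,Y_N$ in any way. For $1\le K\le N$ let $B_1,\dots,B_K\subseteq\{1,\dots,N\}$ be disjoint blocks of size $\lfloor N/K\rfloor$ (the remaining indices are discarded), and let $\bar X_k$ be the mean of the $X_i$ with $i\in B_k$. For real numbers $a_1,\dots,a_K$ let $\mathrm{Med}(a_k)$ be the smallest $a_i$ such that at least $K/2$ of the $a_j$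 are $\le a_i$ and at least $K/2$ of them are $\ge a_i$. For $r\ge 0$ put $$S_v(r)=\{y\in E:\ |\mathrm{Med}(\langle\bar X_k,v\rangle:k\le K)-\langle y,v\rangle|\le r\},\qquad \mathbb S_K(r)=\bigcap_{v\in\mathcal B_0^*}S_v(r).$$ The median-of-means estimator $\widehat\mu$ with $K$ blocks is any point of $\mathbb S_K(r_K)$, where $r_K=4R\sqrt{K/N}$. *Claim.* There are universal constants $C,A,c>0$ with the following properties. 1. If $1\le K\le N$ and $K\ge C\,(\mathrm{VC}(\mathcal B_0^*)\vee|\mathcal O|)$ almost surely, then with probability at least $1-e^{-K/128}$ the set $\mathbb S_K(r_K)$ is nonempty and every $\widehat\mu\in\mathbb S_K(r_K)$ satisfies $$\|\widehat\mu-\mu\|\le 8R\sqrt{K/N},$$ with strict inequality if $R>0$. 2. Let $\varepsilon\ge0$, let $\delta\in[e^{-cN},1/2]$, and suppose that $C\,(\mathrm{VC}(\mathcal B_0^*)\vee\lfloor\varepsilon N\rfloor)\le N$. Then there is a number of blocks $K\in\{1,\dots,N\}$, which depends on the normed space, $N$, $\varepsilon$ and $\delta$ but not on the law of $Y_1$,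 such that whenever $|\mathcal O|\le\lfloor\varepsilon N\rfloor$ almost surely, with probability at least $1-\delta$ the set $\mathbb S_K(r_K)$ is nonempty and every $\widehat\mu\in\mathbb S_K(r_K)$ satisfies $$\|\widehat\mu-\mu\|\le A\,R\left(\sqrt{\frac{\mathrm{VC}(\mathcal B_0^*)}{N}}+\sqrt{\frac{128\log(1/\delta)}{N}}+\sqrt{\varepsilon}\right).$$ -/

import Mathlib

open MeasureTheory ProbabilityTheory

universe u w

/-- A class `𝒞` of subsets of `α` shatters the finite set `s` if every subset of `s` is of the form
`s ∩ c` with `c ∈ 𝒞`. -/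
def SetShatters {α : Type*} (𝒞 : Set (Set α)) (s : Finset α) : Prop :=
  ∀ t : Finset α, t ⊆ s → ∃ c ∈ 𝒞, (s : Set α) ∩ c = (t : Set α)

/-- The VC dimension of a class of subsets: the supremum of the cardinalities of the finite sets
that it shatters. -/
noncomputable def setVCDim {α : Type*} (𝒞 : Set (Set α)) : ℕ∞ :=
  ⨆ (s : Finset α) (_ : SetShatters 𝒞 s), (s.card : ℕ∞)

section Space

variable (E : Type*) [NormedAddCommGroup E] [NormedSpace ℝ E]

/-- The extreme points of the closed unit ball of the dual norm. -/
def extremeDual : Set (StrongDual ℝ E) :=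
  Set.extremePoints ℝ (Metric.closedBall (0 : StrongDual ℝ E) 1)

variable {E}

/-- The half-spaces `{x | 0 ≤ v x}` generated by a set `D` of dual vectors. -/
def halfSpaces (D : Set (StrongDual ℝ E)) : Set (Set E) :=
  {H | ∃ v ∈ D, H = {x : E | 0 ≤ v x}}

/-- Half-spaces through the origin have VC dimension at most the dimension of the space; in
particular it is finite, and passing to a natural number below loses nothing. -/
theorem setVCDim_halfSpaces_le [FiniteDimensional ℝ E] (D : Set (StrongDual ℝ E)) :
    setVCDim (halfSpaces D) ≤ (Module.finrank ℝ E : ℕ∞) := by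
  classical
  refine iSup₂_le fun s hs => ?_
  rw [Nat.cast_le]
  by_contra! hlt
  obtain ⟨a, ha, x₀, hx₀, hne⟩ :=
    Module.exists_nontrivial_relation_of_finrank_lt_card (R := ℝ) (M := E) (t := s) hlt
  have key : ∀ b : E → ℝ, ∑ e ∈ s, b e • e = 0 → ∀ x ∈ s, 0 < b x → False := by
    intro b hb x hx hpos
    obtain ⟨c, ⟨v, -, rfl⟩, hv⟩ := hs (s.filter fun e => b e ≤ 0) (Finset.filter_subset _ _)
    have hsum : ∑ e ∈ s, b e * v e = 0 := by
      have h := congrArg v hb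
      simpa [map_sum] using h
    have hmem : ∀ e ∈ s, (0 ≤ v e ↔ b e ≤ 0) := by
      intro e he
      have h : e ∈ (s : Set E) ∩ {x : E | 0 ≤ v x} ↔
          e ∈ ((s.filter fun e => b e ≤ 0 : Finset E) : Set E) := by rw [hv]
      simpa [he] using h
    have hneg : ∑ e ∈ s, b e * v e < ∑ e ∈ s, (0 : ℝ) := by
      refine Finset.sum_lt_sum (fun e he => ?_) ⟨x, hx, ?_⟩
      · rcases le_or_gt (b e) 0 with h | h
        · exact mul_nonpos_of_nonpos_of_nonneg h ((hmem e he).2 h)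
        · exact mul_nonpos_of_nonneg_of_nonpos h.le
            (not_le.1 fun h' => absurd ((hmem e he).1 h') (not_le.2 h)).le
      · exact mul_neg_of_pos_of_neg hpos
          (not_le.1 fun h' => absurd ((hmem x hx).1 h') (not_le.2 hpos))
    simp [hsum] at hneg
  rcases lt_or_gt_of_ne hne with h | h
  · exact key (fun e => -a e) (by simp [ha]) x₀ hx₀ (by simpa using h)
  · exact key a ha x₀ hx₀ h

variable (E)

/-- The VC dimension of the half-spaces generated by the extreme points of the dual unit ball. -/
noncomputable def dualVC : ℕ := (setVCDim (halfSpaces (extremeDual E))).toNat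

variable {E}

/-- The maximal weak standard deviation of a law `ν` on `E`, that is `R` with
`R² = sup_v ∫ (v (y - m))² dν(y)`, `m` the mean of `ν`, `v` running over the extreme points of the
dual unit ball. -/
noncomputable def weakStd [MeasurableSpace E] (ν : Measure E) : ℝ :=
  √(⨆ v : extremeDual E, ∫ y, (v.1 (y - ∫ z, z ∂ν)) ^ 2 ∂ν)

/-- `B` consists of `K` pairwise disjoint blocks of `⌊N / K⌋` indices each; if `K` does not divide
`N`, the remaining indices are discarded. -/
def IsBlocks {N K : ℕ} (B : Fin K → Finset (Fin N)) : Prop :=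
  Pairwise (fun k l => Disjoint (B k) (B l)) ∧ ∀ k, (B k).card = N / K

/-- The mean of the data over the `k`-th block. -/
noncomputable def blockMean {N K : ℕ} (B : Fin K → Finset (Fin N)) (x : Fin N → E) (k : Fin K) :
    E :=
  ((B k).card : ℝ)⁻¹ • ∑ i ∈ B k, x i

/-- The median of `K` real numbers: the smallest `a i` such that at least half of the numbers are
`≤ a i` and at least half of them are `≥ a i`. -/
noncomputable def med {K : ℕ} (a : Fin K → ℝ) : ℝ :=
  sInf {t | ∃ i, t = a i ∧ (K : ℝ) / 2 ≤ (Finset.univ.filter fun j => a j ≤ a i).card ∧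
    (K : ℝ) / 2 ≤ (Finset.univ.filter fun j => a i ≤ a j).card}

/-- The slab `S_v` of the points `y` for which `v y` is within `r` of the median of the numbers
`v (blockMean B x k)`. -/
def momSlab {N K : ℕ} (B : Fin K → Finset (Fin N)) (r : ℝ) (x : Fin N → E)
    (v : StrongDual ℝ E) : Set E :=
  {y | |med (fun k => v (blockMean B x k)) - v y| ≤ r}

/-- The intersection of the slabs over the extreme points of the dual unit ball. A median-of-means
estimator picks any point of it. -/
def momSet {N K : ℕ} (B : Fin K → Finset (Fin N)) (r : ℝ) (x : Fin N → E) : Set E :=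
  ⋂ v ∈ extremeDual E, momSlab B r x v

/-- `Y` is an independent sample with common law `ν` (a law with finite second moment) and `X` is
obtained from it by changing arbitrarily, with knowledge of everything, the entries whose indices
lie in the random set `O`. Neither `X` nor `O` has to be measurable. -/
structure ContaminatedSample [MeasurableSpace E] {Ω : Type*} [MeasurableSpace Ω]
    (P : Measure Ω) (ν : Measure E) {N : ℕ} (Y X : Fin N → Ω → E) (O : Ω → Finset (Fin N)) :
    Prop where
  memLp : MemLp (fun y : E => y) 2 ν
  indep : iIndepFun Y P
  law : ∀ i, HasLaw (Y i) ν P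
  clean : ∀ᵐ ω ∂P, ∀ i, i ∉ O ω → X i ω = Y i ω

end Space

/-!
Write `m` for the mean of `ν`, `R` for `weakStd ν` and `D` for `extremeDual E`. Everything rests on
one event: in no direction `v ∈ D` do as many as `29 K / 60` of the `K` block means of the clean
sample exceed the level `v m + t`, where `t = 3 R √(K / N)`.

* On this event the corrupted entries, which spoil at most `K / 24000` blocks, cannot bring the
  number of exceeding blocks up to `K / 2`. As `D = -D`, all the medians are then within `t` of
  `v m` (`abs_med_sub_le`). So `m` lies in all slabs of radius `4 R √(K / N) ≥ t`, and any other
  point `y` of their intersection satisfies `|v (y - m)| ≤ 7 R √(K / N)` for all `v ∈ D`. By the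
  Krein–Milman lemma, applied to the face of the dual ball exposed by `y - m`, the norm of `y - m` is
  attained in `D` (`norm_sub_le_of_mem_momSet`).
* The event fails with small probability (`measure_exists_blockMean_gt_le`). For a fixed `v`,
  Chebyshev's inequality bounds the probability that a block mean exceeds the level by `2 / 9`. The
  uniformity in `v` comes from a Vapnik–Chervonenkis inequality (`pi_exists_count_ge_le`), proved
  by comparison with a ghost sample, random exchanges between the two samples, Hoeffding's
  inequality for signs, and the Sauer–Shelah lemma.
* The sets to which it is applied are given by `t < v x`, at a level `t` that need not be `0`, while
  `dualVC E` is defined by the level `0`. If `2 p` points are shattered by the sets `t < v x`, then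
  the differences of the points, taken in `p` disjoint pairs, are shattered by the half-spaces
  `0 ≤ v x` (`card_le_of_shatters_traces`). So changing the level at most doubles the dimension, up
  to an additive `1`.

If `E` is nontrivial then `dualVC E` is at least `1`, so that `K` is at least `24000` and absorbs the
constant factors in front of the exponential. At a given confidence level, `K` is the smallest number
of blocks that the first bound admits and for which `exp (-K / 128) ≤ δ`.
-/

/-! ### A one-sided Vapnik–Chervonenkis inequality -/

/-- The Sauer–Shelah lemma as a bound by a generating function: a family is at most as large as the
family of the sets that it shatters, each of which is counted with weight `x ^ card ≥ x ^ d`. -/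
lemma card_mul_pow_le_of_shatters {β : Type*} [Fintype β] [DecidableEq β]
    (𝒜 : Finset (Finset β)) {d : ℕ} (h : ∀ s, 𝒜.Shatters s → s.card ≤ d) {x : ℝ} (hx : 0 ≤ x)
    (hx1 : x ≤ 1) : (𝒜.card : ℝ) * x ^ d ≤ (1 + x) ^ Fintype.card β := by
  calc (𝒜.card : ℝ) * x ^ d ≤ (𝒜.shatterer.card : ℝ) * x ^ d := by
        have h : (𝒜.card : ℝ) ≤ 𝒜.shatterer.card := by
          exact_mod_cast Finset.card_le_card_shatterer 𝒜
        exact mul_le_mul_of_nonneg_right h (pow_nonneg hx d)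
    _ = ∑ s ∈ 𝒜.shatterer, x ^ d := by simp
    _ ≤ ∑ s ∈ 𝒜.shatterer, x ^ s.card := Finset.sum_le_sum fun s hs =>
        pow_le_pow_of_le_one hx hx1 (h s (Finset.mem_shatterer.1 hs))
    _ ≤ ∑ s : Finset β, x ^ s.card :=
        Finset.sum_le_sum_of_subset_of_nonneg (Finset.subset_univ _) fun _ _ _ => by positivity
    _ = (1 + x) ^ Fintype.card β := by
        rw [add_comm, ← Fintype.sum_pow_mul_eq_add_pow]; simp

/-- Hoeffding's inequality for sums `∑ ± c i` with independent fair signs, stated by counting. -/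
lemma card_signs_sum_ge_le {ι : Type*} [Fintype ι] (c : ι → ℝ) (hc : ∀ i, |c i| ≤ 1) {u : ℝ}
    (hu : 0 ≤ u) :
    (Nat.card {s : ι → Bool // u * Fintype.card ι ≤ ∑ i, if s i then -c i else c i} : ℝ) ≤
      2 ^ Fintype.card ι * Real.exp (-(u ^ 2 * Fintype.card ι / 2)) := by
  classical
  set n := Fintype.card ι with hn
  rw [Nat.card_eq_fintype_card, Fintype.card_subtype]
  set S := Finset.univ.filter
    fun s : ι → Bool => u * n ≤ ∑ i, if s i then -c i else c i with hS
  have h1 : (S.card : ℝ) * Real.exp (u * (u * n)) ≤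
      2 ^ n * Real.exp (u ^ 2 * n / 2) := by
    calc (S.card : ℝ) * Real.exp (u * (u * n)) = ∑ s ∈ S, Real.exp (u * (u * n)) := by simp
      _ ≤ ∑ s ∈ S, Real.exp (u * ∑ i, if s i then -c i else c i) := by
          refine Finset.sum_le_sum fun s hs => Real.exp_le_exp.2 ?_
          exact mul_le_mul_of_nonneg_left (Finset.mem_filter.1 hs).2 hu
      _ ≤ ∑ s : ι → Bool, Real.exp (u * ∑ i, if s i then -c i else c i) :=
          Finset.sum_le_sum_of_subset_of_nonneg (Finset.subset_univ _)
            fun _ _ _ => (Real.exp_pos _).le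
      _ = ∑ s : ι → Bool, ∏ i, Real.exp (u * if s i then -c i else c i) := by
          simp_rw [Finset.mul_sum, Real.exp_sum]
      _ = ∏ i, ∑ b : Bool, Real.exp (u * if b then -c i else c i) := by
          rw [Finset.prod_univ_sum, Fintype.piFinset_univ]
      _ ≤ ∏ i : ι, (2 * Real.exp (u ^ 2 / 2)) := by
          refine Finset.prod_le_prod (fun i _ => by positivity) fun i _ => ?_
          have h := Real.cosh_le_exp_half_sq (u * c i)
          rw [Real.cosh_eq] at h
          have h2 : Real.exp ((u * c i) ^ 2 / 2) ≤ Real.exp (u ^ 2 / 2) := by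
            refine Real.exp_le_exp.2 ?_
            have : (c i) ^ 2 ≤ 1 := (sq_le_one_iff_abs_le_one _).2 (hc i)
            nlinarith [sq_nonneg u]
          simp only [Fintype.sum_bool, if_true, Bool.false_eq_true, if_false, mul_neg]
          linarith
      _ = 2 ^ n * Real.exp (u ^ 2 * n / 2) := by
          rw [Finset.prod_const, mul_pow, ← Real.exp_nat_mul, Finset.card_univ, ← hn]
          ring_nf
  have h3 : Real.exp (u ^ 2 * n / 2) =
      Real.exp (-(u ^ 2 * n / 2)) * Real.exp (u * (u * n)) := by
    rw [← Real.exp_add]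
    congr 1
    ring
  rw [h3, ← mul_assoc (2 ^ n)] at h1
  exact le_of_mul_le_mul_right h1 (Real.exp_pos _)

/-- The subsets of the index set that the sets `A v` cut out from the points `x j`. -/
noncomputable def traces {J α V : Type*} [Fintype J] (A : V → Set α) (x : J → α) :
    Finset (Finset J) :=
  open scoped Classical in
  Finset.univ.filter fun s => ∃ v, ∀ j, j ∈ s ↔ x j ∈ A v

lemma mem_traces {J α V : Type*} [Fintype J] {A : V → Set α} {x : J → α} {s : Finset J} :
    s ∈ traces A x ↔ ∃ v, ∀ j, j ∈ s ↔ x j ∈ A v := by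
  simp [traces]

/-- Exchange the two entries of those pairs that `s` selects. -/
def swapPairs {ι α : Type*} (s : ι → Bool) (w : ι → α × α) : ι → α × α :=
  fun i => if s i then (w i).swap else w i

/-- The two samples listed as one: the index `(i, false)` stands for the first entry of the `i`-th
pair and `(i, true)` for the second one. -/
def joinPairs {ι α : Type*} (w : ι → α × α) : ι × Bool → α :=
  fun j => if j.2 then (w j.1).2 else (w j.1).1

/-- The event that some set `A v` contains at least `q` of the points `(w i).1`, but at most `p` of
the points `(w i).2`. -/
def splitEvent {ι α V : Type*} (A : V → Set α) (q p : ℝ) : Set (ι → α × α) :=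
  {w | ∃ v, q ≤ Nat.card {i // (w i).1 ∈ A v} ∧ (Nat.card {i // (w i).2 ∈ A v} : ℝ) ≤ p}

/-- For fixed pairs, few exchange patterns lead to `splitEvent`: which patterns do so through a given
`A v` depends only on the trace of `A v`, and each trace accounts for few of them by Hoeffding's
inequality. -/
lemma card_swapPairs_mem_splitEvent_le {ι α V : Type*} [Fintype ι] (A : V → Set α)
    (w : ι → α × α) {b u : ℝ} (hu : 0 ≤ u) :
    (Nat.card {s : ι → Bool // swapPairs s w ∈
      splitEvent A ((b + u) * Fintype.card ι) (b * Fintype.card ι)} : ℝ) ≤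
      (traces A (joinPairs w)).card *
        (2 ^ Fintype.card ι * Real.exp (-(u ^ 2 * Fintype.card ι / 2))) := by
  classical
  set n := Fintype.card ι with hn
  let c : Finset (ι × Bool) → ι → ℝ := fun T i =>
    (if (i, false) ∈ T then 1 else 0) - (if (i, true) ∈ T then 1 else 0)
  have hc : ∀ T i, |c T i| ≤ 1 := by
    intro T i; simp only [c]; split_ifs <;> simp
  let S : Finset (ι × Bool) → Finset (ι → Bool) := fun T =>
    Finset.univ.filter fun s => u * n ≤ ∑ i, if s i then -c T i else c T i
  have hS : ∀ T, ((S T).card : ℝ) ≤ 2 ^ n * Real.exp (-(u ^ 2 * n / 2)) := by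
    intro T
    have := card_signs_sum_ge_le (c T) (hc T) hu
    rwa [Nat.card_eq_fintype_card, Fintype.card_subtype] at this
  rw [Nat.card_eq_fintype_card, Fintype.card_subtype]
  have hsub : (Finset.univ.filter fun s : ι → Bool => swapPairs s w ∈
      splitEvent A ((b + u) * n) (b * n)) ⊆ (traces A (joinPairs w)).biUnion S := by
    intro s hs
    obtain ⟨v, h1, h2⟩ := (Finset.mem_filter.1 hs).2
    obtain ⟨T, hT⟩ : ∃ T : Finset (ι × Bool), ∀ j, j ∈ T ↔ joinPairs w j ∈ A v :=
      ⟨Finset.univ.filter fun j => joinPairs w j ∈ A v, by simp⟩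
    refine Finset.mem_biUnion.2 ⟨T, mem_traces.2 ⟨v, hT⟩, ?_⟩
    refine Finset.mem_filter.2 ⟨Finset.mem_univ _, ?_⟩
    rw [Nat.card_eq_fintype_card, Fintype.card_subtype, Finset.card_filter] at h1 h2
    push_cast at h1 h2
    have : ∑ i, (if s i then -c T i else c T i) =
        ∑ i, (if (swapPairs s w i).1 ∈ A v then (1 : ℝ) else 0) -
        ∑ i, (if (swapPairs s w i).2 ∈ A v then (1 : ℝ) else 0) := by
      rw [← Finset.sum_sub_distrib]
      refine Finset.sum_congr rfl fun i _ => ?_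
      by_cases h : s i <;> simp [c, swapPairs, h, hT, joinPairs]
    rw [this]
    linarith
  calc _ ≤ (((traces A (joinPairs w)).biUnion S).card : ℝ) := by
        exact_mod_cast Finset.card_le_card hsub
    _ ≤ ∑ T ∈ traces A (joinPairs w), ((S T).card : ℝ) := by
        exact_mod_cast Finset.card_biUnion_le
    _ ≤ ∑ T ∈ traces A (joinPairs w), (2 ^ n * Real.exp (-(u ^ 2 * n / 2))) :=
        Finset.sum_le_sum fun T _ => hS T
    _ = _ := by rw [Finset.sum_const, nsmul_eq_mul]

section Measure

variable {ι α V : Type*} [Fintype ι] [MeasurableSpace α] (ρ : Measure α) [IsProbabilityMeasure ρ]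

lemma natCard_eq_sum_indicator {J β : Type*} [Fintype J] (x : J → β) (A : Set β) :
    (Nat.card {i // x i ∈ A} : ENNReal) = ∑ i, A.indicator 1 (x i) := by
  classical
  rw [Nat.card_eq_fintype_card, Fintype.card_subtype, Finset.card_filter]
  push_cast
  simp [Set.indicator_apply]

lemma measurable_natCard_mem {A : Set α} (hA : MeasurableSet A) :
    Measurable fun z : ι → α => (Nat.card {i // z i ∈ A} : ℝ) := by
  have h : Measurable fun z : ι → α => (Nat.card {i // z i ∈ A} : ENNReal) := by
    simp_rw [natCard_eq_sum_indicator]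
    exact Finset.measurable_sum _ fun i _ =>
      (measurable_one.indicator hA).comp (measurable_pi_apply i)
  simpa using h.ennreal_toReal

lemma measurableSet_splitEvent [Countable V] {A : V → Set α} (hA : ∀ v, MeasurableSet (A v))
    (q p : ℝ) : MeasurableSet (splitEvent A q p : Set (ι → α × α)) := by
  have : (splitEvent A q p : Set (ι → α × α)) = ⋃ v,
      ({w | q ≤ Nat.card {i // (w i).1 ∈ A v}} ∩
        {w | (Nat.card {i // (w i).2 ∈ A v} : ℝ) ≤ p}) := by
    ext w; simp [splitEvent]
  rw [this]
  refine MeasurableSet.iUnion fun v => .inter ?_ ?_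
  · exact measurableSet_le measurable_const ((measurable_natCard_mem (hA v)).comp
      (measurable_pi_lambda (fun w : ι → α × α => fun i => (w i).1) fun i => by fun_prop))
  · exact measurableSet_le ((measurable_natCard_mem (hA v)).comp
      (measurable_pi_lambda (fun w : ι → α × α => fun i => (w i).2) fun i => by fun_prop))
      measurable_const

lemma measurePreserving_swapPairs (s : ι → Bool) :
    MeasurePreserving (swapPairs s) (Measure.pi fun _ : ι => ρ.prod ρ)
      (Measure.pi fun _ : ι => ρ.prod ρ) := by
  refine measurePreserving_pi _ _ (f := fun i (p : α × α) => if s i then p.swap else p) fun i => ?_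
  by_cases h : s i
  · simpa [h] using Measure.measurePreserving_swap
  · simp only [h, Bool.false_eq_true, if_false]
    exact MeasurePreserving.id _

/-- The law of the pairs is invariant under exchanges, so the bound on the proportion of exchange
patterns integrates to a bound on the probability. -/
lemma pi_splitEvent_le [Countable V] {A : V → Set α} (hA : ∀ v, MeasurableSet (A v)) {M b u : ℝ}
    (hM : ∀ x : ι × Bool → α, ((traces A x).card : ℝ) ≤ M) (hu : 0 ≤ u) :
    (Measure.pi fun _ : ι => ρ.prod ρ)
      (splitEvent A ((b + u) * Fintype.card ι) (b * Fintype.card ι)) ≤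
      ENNReal.ofReal (M * Real.exp (-(u ^ 2 * Fintype.card ι / 2))) := by
  classical
  set n := Fintype.card ι with hn
  set W : Set (ι → α × α) := splitEvent A ((b + u) * n) (b * n) with hWdef
  have hW : MeasurableSet W := measurableSet_splitEvent hA _ _
  set π := Measure.pi fun _ : ι => ρ.prod ρ
  have hsum : (2 : ENNReal) ^ n * π W = ∑ s : ι → Bool, π (swapPairs s ⁻¹' W) := by
    rw [Finset.sum_congr rfl fun s _ =>
      (measurePreserving_swapPairs ρ s).measure_preimage hW.nullMeasurableSet]
    simp [n, π]
  have hM0 : ∀ w : ι → α × α, (Nat.card {s : ι → Bool // swapPairs s w ∈ W} : ℝ) ≤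
      2 ^ n * (M * Real.exp (-(u ^ 2 * n / 2))) := by
    intro w
    refine (card_swapPairs_mem_splitEvent_le A w hu).trans ?_
    rw [← hn, mul_left_comm]
    gcongr
    exact hM _
  have hle : ∑ s : ι → Bool, π (swapPairs s ⁻¹' W) ≤
      2 ^ n * ENNReal.ofReal (M * Real.exp (-(u ^ 2 * n / 2))) := by
    calc ∑ s : ι → Bool, π (swapPairs s ⁻¹' W)
        = ∑ s : ι → Bool, ∫⁻ w, (swapPairs s ⁻¹' W).indicator 1 w ∂π := by
          refine Finset.sum_congr rfl fun s _ => ?_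
          rw [lintegral_indicator_one ((measurePreserving_swapPairs ρ s).measurable hW)]
      _ = ∫⁻ w, ∑ s : ι → Bool, (swapPairs s ⁻¹' W).indicator 1 w ∂π := by
          rw [lintegral_finsetSum]
          exact fun s _ => measurable_one.indicator
            ((measurePreserving_swapPairs ρ s).measurable hW)
      _ ≤ ∫⁻ _, ENNReal.ofReal (2 ^ n * (M * Real.exp (-(u ^ 2 * n / 2)))) ∂π := by
          refine lintegral_mono fun w => ?_
          have h := natCard_eq_sum_indicator (fun s : ι → Bool => swapPairs s w) W
          have h' : ∑ s : ι → Bool, (swapPairs s ⁻¹' W).indicator (1 : (ι → α × α) → ENNReal) w =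
              ∑ s : ι → Bool, W.indicator 1 (swapPairs s w) := rfl
          dsimp only
          rw [h', ← h, ← ENNReal.ofReal_natCast]
          exact ENNReal.ofReal_le_ofReal (hM0 w)
      _ = _ := by
          rw [lintegral_const, measure_univ, mul_one, ENNReal.ofReal_mul (by positivity)]
          simp [ENNReal.ofReal_pow]
  rw [← hsum] at hle
  exact (ENNReal.mul_le_mul_iff_right (by simp) (by simp)).1 hle

/-- Markov's inequality for the number of hits of `A`. -/
lemma pi_count_gt_le {A : Set α} (hA : MeasurableSet A) {b : ℝ} (hb : 0 < b)
    (h : 3 * ρ.real A ≤ 2 * b) [Nonempty ι] :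
    (Measure.pi fun _ : ι => ρ) {z | b * Fintype.card ι < Nat.card {i // z i ∈ A}} ≤
      ENNReal.ofReal (2 / 3) := by
  set n := Fintype.card ι with hn
  have hn0 : 0 < n := Fintype.card_pos
  have hbn : 0 < b * n := by positivity
  set μ := Measure.pi fun _ : ι => ρ
  have hint : ∫⁻ z, (Nat.card {i // z i ∈ A} : ENNReal) ∂μ = n * ρ A := by
    simp_rw [natCard_eq_sum_indicator]
    rw [lintegral_finsetSum (f := fun i (z : ι → α) => A.indicator (1 : α → ENNReal) (z i)) _
      fun i _ => (measurable_one.indicator hA).comp (measurable_pi_apply i)]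
    have : ∀ i, ∫⁻ z : ι → α, A.indicator (1 : α → ENNReal) (z i) ∂μ = ρ A := by
      intro i
      rw [← lintegral_indicator_one hA, (measurePreserving_eval (fun _ : ι => ρ) i).lintegral_comp
        (measurable_one.indicator hA)]
    simp [this, n]
  have hmark := mul_meas_ge_le_lintegral₀ (μ := μ)
    (f := fun z : ι → α => (Nat.card {i // z i ∈ A} : ENNReal)) (by
      simp_rw [natCard_eq_sum_indicator]
      exact (Finset.measurable_sum _ fun i _ =>
        (measurable_one.indicator hA).comp (measurable_pi_apply i)).aemeasurable)
    (ENNReal.ofReal (b * n))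
  rw [hint] at hmark
  have hsub : {z : ι → α | b * n < Nat.card {i // z i ∈ A}} ⊆
      {z | ENNReal.ofReal (b * n) ≤ (Nat.card {i // z i ∈ A} : ENNReal)} := by
    intro z hz
    rw [Set.mem_ofPred_eq] at hz ⊢
    rw [← ENNReal.ofReal_natCast]
    exact ENNReal.ofReal_le_ofReal hz.le
  refine (measure_mono hsub).trans ?_
  have hpos : ENNReal.ofReal (b * n) ≠ 0 := by simpa using hbn
  refine (ENNReal.mul_le_mul_iff_right hpos ENNReal.ofReal_ne_top).1 (hmark.trans ?_)
  rw [← ENNReal.ofReal_mul hbn.le, ← ofReal_measureReal, ← ENNReal.ofReal_natCast,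
    ← ENNReal.ofReal_mul (by positivity)]
  refine ENNReal.ofReal_le_ofReal ?_
  have : (0 : ℝ) < n := by exact_mod_cast hn0
  nlinarith

/-- **Vapnik–Chervonenkis inequality**, one-sided: if all the sets `A v` have probability at most
`2 b / 3`, it is unlikely that one of them contains a proportion `b + u` of an independent sample.
A ghost sample has, with probability at least `1 / 3`, a proportion of at most `b` in that set, so
that the pair of samples lies in `splitEvent`. -/
lemma pi_exists_count_ge_le [Countable V] [Nonempty ι] {A : V → Set α}
    (hA : ∀ v, MeasurableSet (A v)) {M b u : ℝ} (hb : 0 < b) (hu : 0 ≤ u)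
    (hAb : ∀ v, 3 * ρ.real (A v) ≤ 2 * b)
    (hM : ∀ x : ι × Bool → α, ((traces A x).card : ℝ) ≤ M) :
    (Measure.pi fun _ : ι => ρ)
      {z | ∃ v, (b + u) * Fintype.card ι ≤ Nat.card {i // z i ∈ A v}} ≤
      ENNReal.ofReal (3 * (M * Real.exp (-(u ^ 2 * Fintype.card ι / 2)))) := by
  set n := Fintype.card ι with hn
  set μ := Measure.pi fun _ : ι => ρ with hμ
  set U : Set (ι → α) := {z | ∃ v, (b + u) * n ≤ Nat.card {i // z i ∈ A v}} with hU
  have hUm : MeasurableSet U := by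
    have : U = ⋃ v, {z | (b + u) * n ≤ Nat.card {i // z i ∈ A v}} := by ext; simp [hU]
    rw [this]
    exact .iUnion fun v => measurableSet_le measurable_const (measurable_natCard_mem (hA v))
  set W : Set (ι → α × α) := splitEvent A ((b + u) * n) (b * n) with hWdef
  have hW : MeasurableSet W := measurableSet_splitEvent hA _ _
  have hWle := pi_splitEvent_le (ι := ι) ρ hA (b := b) hM hu
  rw [← hn, ← hWdef] at hWle
  set e := MeasurableEquiv.arrowProdEquivProdArrow α α ι
  have he := (measurePreserving_arrowProdEquivProdArrow α α ι (fun _ => ρ) (fun _ => ρ)).symm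
  have h1 : (Measure.pi fun _ : ι => ρ.prod ρ) W = (μ.prod μ) (e.symm ⁻¹' W) :=
    (he.measure_preimage hW.nullMeasurableSet).symm
  rw [h1, Measure.prod_apply (e.symm.measurable hW)] at hWle
  have h2 : ∫⁻ z, U.indicator (fun _ => ENNReal.ofReal (1 / 3)) z ∂μ ≤
      ∫⁻ z, μ (Prod.mk z ⁻¹' (e.symm ⁻¹' W)) ∂μ := by
    refine lintegral_mono fun z => ?_
    by_cases hz : z ∈ U
    · obtain ⟨v, hv⟩ := hz
      rw [Set.indicator_of_mem (show z ∈ U from ⟨v, hv⟩)]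
      have hgt := pi_count_gt_le (ι := ι) ρ (hA v) hb (hAb v)
      rw [← hn, ← hμ] at hgt
      have hm : MeasurableSet {z : ι → α | b * n < Nat.card {i // z i ∈ A v}} :=
        measurableSet_lt measurable_const (measurable_natCard_mem (hA v))
      have hc := prob_compl_eq_one_sub (μ := μ) hm
      calc ENNReal.ofReal (1 / 3) = 1 - ENNReal.ofReal (2 / 3) := by
            rw [← ENNReal.ofReal_one, ← ENNReal.ofReal_sub _ (by norm_num)]; norm_num
        _ ≤ 1 - μ {z : ι → α | b * n < Nat.card {i // z i ∈ A v}} := tsub_le_tsub_left hgt _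
        _ = μ {z : ι → α | b * n < Nat.card {i // z i ∈ A v}}ᶜ := hc.symm
        _ ≤ _ := by
            refine measure_mono fun z' hz' => ?_
            exact ⟨v, hv, not_lt.1 hz'⟩
    · rw [Set.indicator_of_notMem hz]; exact bot_le
  rw [lintegral_indicator_const hUm] at h2
  have h3 := h2.trans hWle
  have h4 : μ U = ENNReal.ofReal 3 * (ENNReal.ofReal (1 / 3) * μ U) := by
    rw [← mul_assoc, ← ENNReal.ofReal_mul (by norm_num)]; norm_num
  rw [h4, ENNReal.ofReal_mul (by norm_num)]
  gcongr

end Measure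

/-! ### Extreme points of the dual ball and the dimension `dualVC` -/

section Geometry

variable {E : Type*} [NormedAddCommGroup E] [NormedSpace ℝ E]

lemma neg_mem_extremeDual {v : StrongDual ℝ E} (hv : v ∈ extremeDual E) : -v ∈ extremeDual E := by
  refine ⟨by simpa using hv.1, fun x hx y hy hxy => ?_⟩
  have h := hv.2 (x₁ := -x) (by simpa using hx) (x₂ := -y) (by simpa using hy) (by
    obtain ⟨a, b, ha, hb, hab, h⟩ := hxy
    exact ⟨a, b, ha, hb, hab, by rw [smul_neg, smul_neg, ← neg_add, h, neg_neg]⟩)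
  rw [← h, neg_neg]

/-- The functionals of the dual ball with `v x = ‖x‖` form a nonempty compact face, and an extreme
point of the face is an extreme point of the ball. -/
lemma exists_extremeDual_apply_eq_norm [FiniteDimensional ℝ E] (x : E) :
    ∃ v ∈ extremeDual E, v x = ‖x‖ := by
  have : FiniteDimensional ℝ (StrongDual ℝ E) := inferInstance
  have : ProperSpace (StrongDual ℝ E) := FiniteDimensional.proper ℝ _
  set A : Set (StrongDual ℝ E) := Metric.closedBall 0 1
  have hA : IsCompact A := isCompact_closedBall _ _
  set l : StrongDual ℝ (StrongDual ℝ E) := ContinuousLinearMap.apply ℝ ℝ x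
  have hl : ∀ v, l v = v x := fun v => rfl
  have hle : ∀ v ∈ A, v x ≤ ‖x‖ := by
    intro v hv
    have hv1 : ‖v‖ ≤ 1 := by simpa [A] using hv
    exact (le_abs_self _).trans ((v.le_of_opNorm_le hv1 x).trans (by simp))
  obtain ⟨g, hg1, hgx⟩ := exists_dual_vector'' ℝ x
  have hgA : g ∈ A := by simpa [A] using hg1
  have hexp : IsExposed ℝ A (l.toExposed A) := ContinuousLinearMap.toExposed.isExposed
  obtain ⟨v, hv⟩ := (hexp.isCompact hA).extremePoints_nonempty
    ⟨g, hgA, fun w hw => by rw [hl, hl, hgx]; exact hle w hw⟩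
  refine ⟨v, hexp.isExtreme.extremePoints_subset_extremePoints hv, le_antisymm ?_ ?_⟩
  · exact hle v hv.1.1
  · have := hv.1.2 g hgA
    rw [hl, hl, hgx] at this
    exact this

lemma card_le_dualVC [FiniteDimensional ℝ E] {s : Finset E}
    (hs : SetShatters (halfSpaces (extremeDual E)) s) : s.card ≤ dualVC E := by
  have hfin : setVCDim (halfSpaces (extremeDual E)) ≠ ⊤ :=
    ne_top_of_le_ne_top (ENat.natCast_ne_top _) (setVCDim_halfSpaces_le _)
  have h : (s.card : ℕ∞) ≤ setVCDim (halfSpaces (extremeDual E)) :=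
    le_iSup₂ (f := fun (s : Finset E) (_ : SetShatters (halfSpaces (extremeDual E)) s) =>
      (s.card : ℕ∞)) s hs
  exact ENat.toNat_le_toNat h hfin

/-- Vectors on which the signs of the functionals of `extremeDual E` can be prescribed at will are
distinct, and the half-spaces shatter them. -/
lemma card_le_dualVC_of_signs [FiniteDimensional ℝ E] {J : Type*} [Fintype J] (y : J → E)
    (h : ∀ S : Set J, ∃ v ∈ extremeDual E, ∀ i, (i ∈ S → 0 < v (y i)) ∧ (i ∉ S → v (y i) < 0)) :
    Fintype.card J ≤ dualVC E := by
  classical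
  have hinj : Function.Injective y := by
    intro i j hij
    by_contra hne
    obtain ⟨v, -, hv⟩ := h {i}
    have h1 := (hv i).1 rfl
    have h2 := (hv j).2 (fun h => hne h.symm)
    rw [hij] at h1
    exact lt_asymm h1 h2
  rw [← Finset.card_univ, ← Finset.card_image_of_injective _ hinj]
  refine card_le_dualVC fun T hT => ?_
  obtain ⟨v, hv, hvS⟩ := h {i | y i ∈ T}
  refine ⟨_, ⟨v, hv, rfl⟩, ?_⟩
  ext z
  constructor
  · rintro ⟨hz, hz0⟩
    obtain ⟨i, -, rfl⟩ := Finset.mem_image.1 hz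
    by_contra hzT
    exact absurd ((hvS i).2 hzT) (not_lt.2 hz0)
  · intro hz
    have hz' := hT hz
    obtain ⟨i, -, rfl⟩ := Finset.mem_image.1 hz'
    exact ⟨hz', ((hvS i).1 hz).le⟩

lemma one_le_dualVC [FiniteDimensional ℝ E] [Nontrivial E] : 1 ≤ dualVC E := by
  obtain ⟨x, hx⟩ := exists_ne (0 : E)
  obtain ⟨v, hv, hvx⟩ := exists_extremeDual_apply_eq_norm x
  have hpos : 0 < v x := hvx ▸ norm_pos_iff.2 hx
  refine card_le_dualVC_of_signs (J := Unit) (fun _ => x) fun S => ?_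
  by_cases hS : () ∈ S
  · exact ⟨v, hv, fun i => ⟨fun _ => hpos, fun h => absurd hS h⟩⟩
  · exact ⟨-v, neg_mem_extremeDual hv, fun i => ⟨fun h => absurd h hS, fun _ => by simpa⟩⟩

/-- Half-spaces at a fixed level `t` have dimension at most `2 * dualVC E + 1`. If they shatter `2 p`
points, grouped in pairs, one can prescribe for each pair which of its points lies above the level;
this prescribes the sign of `v` on the difference of the pair. -/
lemma card_le_of_shatters_traces [FiniteDimensional ℝ E] {α V J : Type*} [Fintype J]
    [DecidableEq J] (g : V → StrongDual ℝ E) (hg : ∀ v, g v ∈ extremeDual E) (f : α → E) (t : ℝ)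
    (x : J → α) {s : Finset J} (hs : (traces (fun v => {a | t < g v (f a)}) x).Shatters s) :
    s.card ≤ 2 * dualVC E + 1 := by
  classical
  by_contra! hlt
  set m := dualVC E + 1 with hm
  have hcard : Fintype.card (Fin m × Bool) ≤ Fintype.card s := by
    simp; omega
  obtain ⟨e⟩ := Function.Embedding.nonempty_of_card_le hcard
  have key : Fintype.card (Fin m) ≤ dualVC E := by
    refine card_le_dualVC_of_signs
      (fun i => f (x (e (i, false))) - f (x (e (i, true)))) fun S => ?_
    obtain ⟨u, hu, hsu⟩ := hs (t := s.filter fun j =>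
      ∃ i, (i ∈ S ∧ j = e (i, false)) ∨ (i ∉ S ∧ j = e (i, true))) (Finset.filter_subset _ _)
    obtain ⟨v, hv⟩ := mem_traces.1 hu
    have hmem : ∀ p, t < g v (f (x (e p))) ↔
        ∃ i, (i ∈ S ∧ p = (i, false)) ∨ (i ∉ S ∧ p = (i, true)) := by
      intro p
      have h1 := Finset.ext_iff.1 hsu (e p)
      simpa [hv, Subtype.val_inj] using h1
    refine ⟨g v, hg v, fun i => ⟨fun hi => ?_, fun hi => ?_⟩⟩
    · have h1 := (hmem (i, false)).2 ⟨i, .inl ⟨hi, rfl⟩⟩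
      have h2 : ¬ t < g v (f (x (e (i, true)))) := by
        rw [hmem]; simp [hi]
      rw [map_sub]; linarith
    · have h1 := (hmem (i, true)).2 ⟨i, .inr ⟨hi, rfl⟩⟩
      have h2 : ¬ t < g v (f (x (e (i, false)))) := by
        rw [hmem]; simp [hi]
      rw [map_sub]; linarith
  simp [hm] at key

/-- The Sauer–Shelah bound for half-spaces at a fixed level. The weight `1 / 2000` keeps the growth in
the number of points small, at the price of a large multiple of the dimension. -/
lemma card_traces_le [FiniteDimensional ℝ E] [Nontrivial E] {α V J : Type*} [Fintype J]
    (g : V → StrongDual ℝ E) (hg : ∀ v, g v ∈ extremeDual E) (f : α → E) (t : ℝ) (x : J → α) :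
    ((traces (fun v => {a | t < g v (f a)}) x).card : ℝ) ≤
      Real.exp (24 * dualVC E + Fintype.card J / 2000) := by
  classical
  set S := traces (fun v => {a | t < g v (f a)}) x
  have hV : 1 ≤ dualVC E := one_le_dualVC
  have h := card_mul_pow_le_of_shatters S (d := 3 * dualVC E) (fun s hs =>
    (card_le_of_shatters_traces g hg f t x hs).trans (by omega)) (x := 1 / 2000)
    (by norm_num) (by norm_num)
  have h8 : (2000 : ℝ) ≤ Real.exp 8 := by
    have h1 : (2.7 : ℝ) ≤ Real.exp 1 := by linarith [Real.exp_one_gt_d9]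
    calc (2000 : ℝ) ≤ 2.7 ^ 8 := by norm_num
      _ ≤ Real.exp 1 ^ 8 := by gcongr
      _ = Real.exp 8 := by rw [← Real.exp_nat_mul]; norm_num
  have h2 : (1 + 1 / 2000 : ℝ) ^ Fintype.card J ≤ Real.exp (Fintype.card J / 2000) := by
    calc (1 + 1 / 2000 : ℝ) ^ Fintype.card J ≤ Real.exp (1 / 2000) ^ Fintype.card J := by
          gcongr
          linarith [Real.add_one_le_exp (1 / 2000 : ℝ)]
      _ = _ := by rw [← Real.exp_nat_mul]; ring_nf
  have h3 : (2000 : ℝ) ^ (3 * dualVC E) ≤ Real.exp (24 * dualVC E) := by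
    calc (2000 : ℝ) ^ (3 * dualVC E) ≤ Real.exp 8 ^ (3 * dualVC E) := by gcongr
      _ = _ := by rw [← Real.exp_nat_mul]; push_cast; ring_nf
  rw [one_div, inv_pow, ← div_eq_mul_inv, div_le_iff₀ (by positivity), ← one_div] at h
  calc (S.card : ℝ) ≤ _ := h
    _ ≤ Real.exp (Fintype.card J / 2000) * Real.exp (24 * dualVC E) := by gcongr
    _ = _ := by rw [← Real.exp_add, add_comm]

end Geometry

/-! ### Medians and corrupted blocks -/

section Median

variable {K : ℕ}

/-- The set whose infimum defines `med a` is nonempty, so that `med a` is one of the entries. -/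
lemma exists_med_eq (hK : 1 ≤ K) (a : Fin K → ℝ) :
    ∃ i, med a = a i ∧ (K : ℝ) / 2 ≤ (Finset.univ.filter fun j => a j ≤ a i).card ∧
      (K : ℝ) / 2 ≤ (Finset.univ.filter fun j => a i ≤ a j).card := by
  have hfin : {t | ∃ i, t = a i ∧ (K : ℝ) / 2 ≤ (Finset.univ.filter fun j => a j ≤ a i).card ∧
      (K : ℝ) / 2 ≤ (Finset.univ.filter fun j => a i ≤ a j).card}.Finite :=
    (Set.finite_range a).subset (by rintro t ⟨i, rfl, -⟩; exact ⟨i, rfl⟩)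
  refine Set.Nonempty.csInf_mem ?_ hfin
  have : Nonempty (Fin K) := ⟨⟨0, hK⟩⟩
  have hK0 : (0 : ℝ) ≤ K := K.cast_nonneg
  obtain ⟨i₀, hi₀⟩ := Finite.exists_max a
  -- the smallest entry below which at least half of the entries lie
  obtain ⟨i, hi, hmin⟩ := Finset.exists_min_image
    (Finset.univ.filter fun i => (K : ℝ) / 2 ≤ (Finset.univ.filter fun j => a j ≤ a i).card) a
    ⟨i₀, by simp [hi₀]⟩
  rw [Finset.mem_filter] at hi
  refine ⟨a i, i, rfl, hi.2, ?_⟩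
  have hlt : ((Finset.univ.filter fun j => a j < a i).card : ℝ) ≤ K / 2 := by
    rcases (Finset.univ.filter fun j => a j < a i).eq_empty_or_nonempty with h | h
    · rw [h, Finset.card_empty, Nat.cast_zero]; linarith
    · obtain ⟨l, hl, hmax⟩ := Finset.exists_max_image _ a h
      rw [Finset.mem_filter] at hl
      have hl' : ¬ (K : ℝ) / 2 ≤ (Finset.univ.filter fun j => a j ≤ a l).card := fun hc =>
        absurd (hmin l (by simp [hc])) (not_le.2 hl.2)
      refine le_trans ?_ (not_le.1 hl').le
      exact_mod_cast Finset.card_le_card fun j hj => by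
        simpa using hmax j hj
  have hsum := Finset.card_filter_add_card_filter_not (s := (Finset.univ : Finset (Fin K)))
    (fun j => a j < a i)
  simp only [not_lt, Finset.card_univ, Fintype.card_fin] at hsum
  have : ((Finset.univ.filter fun j => a j < a i).card : ℝ) +
    (Finset.univ.filter fun j => a i ≤ a j).card = K := by exact_mod_cast hsum
  linarith

lemma med_le_of_card_lt (hK : 1 ≤ K) {a : Fin K → ℝ} {c : ℝ}
    (h : ((Finset.univ.filter fun j => c < a j).card : ℝ) < K / 2) : med a ≤ c := by
  obtain ⟨i, hi, -, h2⟩ := exists_med_eq hK a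
  rw [hi]
  by_contra! hc
  refine absurd (h2.trans ?_) (not_le.2 h)
  exact_mod_cast Finset.card_le_card fun j hj => by
    simp only [Finset.mem_filter, Finset.mem_univ, true_and] at hj ⊢
    exact hc.trans_le hj

lemma le_med_of_card_lt (hK : 1 ≤ K) {a : Fin K → ℝ} {c : ℝ}
    (h : ((Finset.univ.filter fun j => a j < c).card : ℝ) < K / 2) : c ≤ med a := by
  obtain ⟨i, hi, h1, -⟩ := exists_med_eq hK a
  rw [hi]
  by_contra! hc
  refine absurd (h1.trans ?_) (not_le.2 h)
  exact_mod_cast Finset.card_le_card fun j hj => by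
    simp only [Finset.mem_filter, Finset.mem_univ, true_and] at hj ⊢
    exact hj.trans_lt hc

end Median

section Deterministic

variable {E : Type*} [NormedAddCommGroup E] [NormedSpace ℝ E] {N K : ℕ}

lemma card_filter_exists_mem_le {B : Fin K → Finset (Fin N)}
    (hB : Pairwise fun k l => Disjoint (B k) (B l)) (O : Finset (Fin N)) :
    (Finset.univ.filter fun k => ∃ i ∈ B k, i ∈ O).card ≤ O.card := by
  classical
  rcases isEmpty_or_nonempty (Fin N) with hN | hN
  · simp
  choose! f hf using fun (k : Fin K) (h : ∃ i ∈ B k, i ∈ O) => h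
  refine Finset.card_le_card_of_injOn f (fun k hk => (hf k (by simpa using hk)).2) ?_
  intro k hk l hl hkl
  by_contra hne
  have h1 := (hf k (by simpa using hk)).1
  have h2 := (hf l (by simpa using hl)).1
  rw [hkl] at h1
  exact Finset.disjoint_left.1 (hB hne) h1 h2

lemma blockMean_congr {B : Fin K → Finset (Fin N)} {x y : Fin N → E} {k : Fin K}
    (h : ∀ i ∈ B k, x i = y i) : blockMean B x k = blockMean B y k := by
  rw [blockMean, blockMean, Finset.sum_congr rfl h]

/-- If in no direction too many clean block means exceed `v m` by more than `t`, then, in spite of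
the corrupted entries, `v m` is within `t` of all the medians. -/
lemma abs_med_sub_le (hK : 1 ≤ K) {B : Fin K → Finset (Fin N)}
    (hB : Pairwise fun k l => Disjoint (B k) (B l)) {x y : Fin N → E} {O : Finset (Fin N)}
    (hxy : ∀ i, i ∉ O → x i = y i) {q t : ℝ} (m : E) (hq : q + O.card ≤ K / 2)
    (hy : ∀ v ∈ extremeDual E, (Nat.card {k // t < v (blockMean B y k) - v m} : ℝ) < q)
    {v : StrongDual ℝ E} (hv : v ∈ extremeDual E) :
    |med (fun k => v (blockMean B x k)) - v m| ≤ t := by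
  classical
  have hx : ∀ w ∈ extremeDual E,
      ((Finset.univ.filter fun k => t < w (blockMean B x k) - w m).card : ℝ) < K / 2 := by
    intro w hw
    have h1 := hy w hw
    rw [Nat.card_eq_fintype_card, Fintype.card_subtype] at h1
    have hsub : (Finset.univ.filter fun k => t < w (blockMean B x k) - w m) ⊆
        (Finset.univ.filter fun k => t < w (blockMean B y k) - w m) ∪
        (Finset.univ.filter fun k => ∃ i ∈ B k, i ∈ O) := by
      intro k hk
      simp only [Finset.mem_union, Finset.mem_filter, Finset.mem_univ, true_and] at hk ⊢
      by_cases hO : ∃ i ∈ B k, i ∈ O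
      · exact .inr hO
      · push Not at hO
        rw [blockMean_congr fun i hi => hxy i (hO i hi)] at hk
        exact .inl hk
    have h2 := (Finset.card_le_card hsub).trans (Finset.card_union_le _ _)
    have h3 := h2.trans (Nat.add_le_add_left (card_filter_exists_mem_le hB O) _)
    have h4 : ((Finset.univ.filter fun k => t < w (blockMean B x k) - w m).card : ℝ) ≤
      (Finset.univ.filter fun k => t < w (blockMean B y k) - w m).card + O.card := by
      exact_mod_cast h3
    linarith
  rw [abs_le]
  constructor
  · have h := hx (-v) (neg_mem_extremeDual hv)
    have : v m - t ≤ med (fun k => v (blockMean B x k)) := by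
      refine le_med_of_card_lt hK (lt_of_eq_of_lt ?_ h)
      congr 2
      ext k
      simp only [Finset.mem_filter, neg_apply]
      constructor <;> rintro ⟨h1, h2⟩ <;> exact ⟨h1, by linarith⟩
    linarith
  · have h := hx v hv
    have : med (fun k => v (blockMean B x k)) ≤ v m + t := by
      refine med_le_of_card_lt hK (lt_of_eq_of_lt ?_ h)
      congr 2
      ext k
      simp only [Finset.mem_filter]
      constructor <;> rintro ⟨h1, h2⟩ <;> exact ⟨h1, by linarith⟩
    linarith

/-- The bound `|v (y - m)| ≤ r + t` in the direction `v` that attains the norm of `y - m`. -/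
lemma norm_sub_le_of_mem_momSet [FiniteDimensional ℝ E] {B : Fin K → Finset (Fin N)}
    {x : Fin N → E} {m y : E} {r t : ℝ} (hy : y ∈ momSet B r x)
    (hm : ∀ v ∈ extremeDual E, |med (fun k => v (blockMean B x k)) - v m| ≤ t) :
    ‖y - m‖ ≤ r + t := by
  obtain ⟨v, hv, hvn⟩ := exists_extremeDual_apply_eq_norm (y - m)
  have h1 : |med (fun k => v (blockMean B x k)) - v y| ≤ r := Set.mem_iInter₂.1 hy v hv
  have h2 := abs_le.1 (hm v hv)
  have h3 := abs_le.1 h1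
  rw [← hvn, map_sub]
  linarith [h2.2, h3.1]

end Deterministic

/-! ### The law of the block means -/

section Probability

/-- Chebyshev's inequality for the mean of an independent sample. The hypothesis on the variance is
written without division, so that `t = 0` is allowed: then `g` is almost surely constant. -/
lemma pi_mean_tail_le {α ι : Type*} [Fintype ι] [Nonempty ι] [MeasurableSpace α] (ν : Measure α)
    [IsProbabilityMeasure ν] {g : α → ℝ} (hg : MemLp g 2 ν) {t p : ℝ} (ht : 0 ≤ t) (hp : 0 ≤ p)
    (hvar : Var[g; ν] ≤ p * Fintype.card ι * t ^ 2) :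
    (Measure.pi fun _ : ι => ν).real
      {u | t < (Fintype.card ι : ℝ)⁻¹ * ∑ j, g (u j) - ν[g]} ≤ p := by
  set n := Fintype.card ι with hn
  have hn0 : (0 : ℝ) < n := by exact_mod_cast (Fintype.card_pos : 0 < Fintype.card ι)
  set μ := Measure.pi fun _ : ι => ν with hμ
  have hmp : ∀ i, MeasurePreserving (Function.eval i) μ ν := fun i =>
    measurePreserving_eval (fun _ : ι => ν) i
  have hgi : ∀ i, MemLp (fun u : ι → α => g (u i)) 2 μ := fun i =>
    hg.comp_measurePreserving (hmp i)
  set X : (ι → α) → ℝ := ∑ i, fun u => g (u i) with hX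
  have hXu : ∀ u, X u = ∑ i, g (u i) := fun u => by simp [hX]
  have hXL : MemLp X 2 μ := memLp_finsetSum' _ fun i _ => hgi i
  have hEi : ∀ i, ∫ u, g (u i) ∂μ = ν[g] := by
    intro i
    have h := integral_map (μ := μ) (hmp i).measurable.aemeasurable (f := g)
      (by rw [(hmp i).map_eq]; exact hg.1)
    rw [(hmp i).map_eq] at h
    exact h.symm
  have hE : ∫ u, X u ∂μ = n * ∫ a, g a ∂ν := by
    simp_rw [hXu]
    rw [integral_finsetSum _ fun i _ => (hgi i).integrable one_le_two]
    simp [hEi, n]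
  have hV : Var[X; μ] = n * Var[g; ν] := by
    rw [hX, hμ, variance_sum_pi (X := fun _ : ι => g) fun _ => hg]
    simp [n]
  have hsub : ∀ u, t < (n : ℝ)⁻¹ * ∑ j, g (u j) - ν[g] → n * t < X u - μ[X] := by
    intro u hu
    have h := mul_lt_mul_of_pos_left hu hn0
    rw [mul_sub, ← mul_assoc, mul_inv_cancel₀ hn0.ne', one_mul, ← hE, ← hXu] at h
    exact h
  rcases ht.eq_or_lt with rfl | ht
  · have hz : Var[X; μ] = 0 := by
      refine le_antisymm ?_ (variance_nonneg _ _)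
      rw [hV]
      exact mul_nonpos_of_nonneg_of_nonpos hn0.le (by simpa using hvar)
    have hae := ae_eq_integral_of_variance_eq_zero hXL hz
    have h0 : μ {u | 0 < (n : ℝ)⁻¹ * ∑ j, g (u j) - ν[g]} = 0 := by
      refine measure_mono_null (fun u hu => ?_) hae
      have := hsub u hu
      rw [mul_zero] at this
      exact (sub_pos.1 this).ne'
    rw [measureReal_def, h0]
    simpa
  · have hch := meas_ge_le_variance_div_sq hXL (mul_pos hn0 ht)
    have hle : Var[X; μ] / (n * t) ^ 2 ≤ p := by
      rw [div_le_iff₀ (by positivity), hV]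
      nlinarith
    refine ENNReal.toReal_le_of_le_ofReal hp ?_
    refine (measure_mono fun u hu => ?_).trans (hch.trans (ENNReal.ofReal_le_ofReal hle))
    exact (hsub u hu).le.trans (le_abs_self _)

variable {E : Type*} [NormedAddCommGroup E] [NormedSpace ℝ E] [FiniteDimensional ℝ E]
  [MeasurableSpace E]

lemma integral_dual_apply {ν : Measure E} [IsFiniteMeasure ν] (hν : MemLp (fun y : E => y) 2 ν)
    (v : StrongDual ℝ E) : ∫ y, v y ∂ν = v (∫ z, z ∂ν) := by
  have : CompleteSpace E := FiniteDimensional.complete ℝ E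
  exact v.integral_comp_comm (hν.integrable one_le_two)

lemma variance_le_weakStd_sq [BorelSpace E] {ν : Measure E} [IsProbabilityMeasure ν]
    (hν : MemLp (fun y : E => y) 2 ν) {v : StrongDual ℝ E} (hv : v ∈ extremeDual E) :
    Var[v; ν] ≤ weakStd ν ^ 2 := by
  set m := ∫ z, z ∂ν
  have hsq : Integrable (fun y => ‖y - m‖ ^ 2) ν := (hν.sub (memLp_const m)).norm.integrable_sq
  have hle : ∀ w : extremeDual E, ∫ y, (w.1 (y - m)) ^ 2 ∂ν ≤ ∫ y, ‖y - m‖ ^ 2 ∂ν := by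
    intro w
    refine integral_mono_of_nonneg (.of_forall fun y => sq_nonneg _) hsq (.of_forall fun y => ?_)
    have hw : ‖w.1‖ ≤ 1 := by simpa using w.2.1
    have := w.1.le_of_opNorm_le hw (y - m)
    rw [one_mul, Real.norm_eq_abs] at this
    exact sq_le_sq' (abs_le.1 this).1 (abs_le.1 this).2
  have hbdd : BddAbove (Set.range fun w : extremeDual E => ∫ y, (w.1 (y - m)) ^ 2 ∂ν) :=
    ⟨_, by rintro _ ⟨w, rfl⟩; exact hle w⟩
  have h := le_ciSup hbdd ⟨v, hv⟩
  rw [weakStd, Real.sq_sqrt (Real.iSup_nonneg fun w => integral_nonneg fun y => sq_nonneg _),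
    variance_eq_integral v.continuous.measurable.aemeasurable]
  rw [integral_dual_apply hν]
  simpa only [map_sub] using h

/-- Independent variables arranged in a rectangular array have independent rows. -/
lemma map_blocks_eq_pi {Ω : Type*} [MeasurableSpace Ω] {P : Measure Ω} [IsProbabilityMeasure P]
    {α ι κ J : Type*} [MeasurableSpace α] [Fintype ι] [Fintype κ] {ν : Measure α}
    [IsProbabilityMeasure ν] {Y : J → Ω → α} (hY : iIndepFun Y P) (hlaw : ∀ i, HasLaw (Y i) ν P)
    {e : ι × κ → J} (he : Function.Injective e) :
    P.map (fun ω (k : ι) (j : κ) => Y (e (k, j)) ω) =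
      Measure.pi fun _ : ι => Measure.pi fun _ : κ => ν := by
  have hm : ∀ p, AEMeasurable (Y (e p)) P := fun p => (hlaw (e p)).aemeasurable
  have h1 := (hY.precomp he).map_fun_eq_pi_map hm
  simp_rw [fun p => (hlaw (e p)).map_eq] at h1
  have h2 := Measure.infinitePi_map_curry (fun (_ : ι) (_ : κ) => ν)
  simp_rw [Measure.infinitePi_eq_pi] at h2
  rw [← h2, ← h1, AEMeasurable.map_map_of_aemeasurable (by fun_prop) (aemeasurable_pi_lambda _ hm)]
  rfl

lemma exists_block_enumeration {N K n : ℕ} {B : Fin K → Finset (Fin N)}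
    (hB : Pairwise fun k l => Disjoint (B k) (B l)) (hcard : ∀ k, (B k).card = n) :
    ∃ e : Fin K × Fin n → Fin N, Function.Injective e ∧
      ∀ (M : Type*) [AddCommMonoid M] (x : Fin N → M) k, ∑ i ∈ B k, x i = ∑ j, x (e (k, j)) := by
  let f : ∀ k, Fin n ≃ B k := fun k => ((B k).equivFinOfCardEq (hcard k)).symm
  refine ⟨fun p => f p.1 p.2, ?_, fun M _ x k => ?_⟩
  · rintro ⟨k, j⟩ ⟨l, i⟩ h
    by_cases hkl : k = l
    · subst hkl
      simpa using h
    · have h' : ((f k j : B k) : Fin N) = (f l i : B l) := h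
      have h1 : ((f k j : B k) : Fin N) ∈ B l := h' ▸ (f l i).2
      exact absurd h1 (Finset.disjoint_left.1 (hB hkl) (f k j).2)
  · rw [← Finset.sum_coe_sort]
    exact ((f k).sum_comp fun i : B k => x i).symm

end Probability

/-! ### Deviations of the block means, uniformly in the direction -/

section Uniform

variable {E : Type*} [NormedAddCommGroup E] [NormedSpace ℝ E] [FiniteDimensional ℝ E]

/-- Exceeding a level strictly is an open condition on the functional, so a countable dense set of
functionals sees all the numbers of exceedances. It makes the event of
`measure_exists_blockMean_gt_le` measurable. -/
lemma exists_countable_extremeDual (E : Type*) [NormedAddCommGroup E] [NormedSpace ℝ E]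
    [FiniteDimensional ℝ E] :
    ∃ D : Set (StrongDual ℝ E), D.Countable ∧ D ⊆ extremeDual E ∧
      ∀ (K : ℕ) (z : Fin K → E) (t : ℝ), ∀ v ∈ extremeDual E, ∃ w ∈ D,
        Nat.card {k // t < v (z k)} ≤ Nat.card {k // t < w (z k)} := by
  have : FiniteDimensional ℝ (StrongDual ℝ E) := inferInstance
  have : ProperSpace (StrongDual ℝ E) := FiniteDimensional.proper ℝ _
  obtain ⟨D, hDsub, hDc, hDd⟩ :=
    (TopologicalSpace.IsSeparable.of_separableSpace (extremeDual E)).exists_countable_dense_subset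
  refine ⟨D, hDc, hDsub, fun K z t v hv => ?_⟩
  have hopen : IsOpen (⋂ k : {k // t < v (z k)}, {w : StrongDual ℝ E | t < w (z k)}) :=
    isOpen_iInter_of_finite fun k =>
      isOpen_lt continuous_const (ContinuousLinearMap.apply ℝ ℝ (z k)).continuous
  obtain ⟨w, hw, hwD⟩ := mem_closure_iff.1 (hDd hv) _ hopen (Set.mem_iInter.2 fun k => k.2)
  refine ⟨w, hwD, Nat.card_le_card_of_injective
    (fun k => ⟨k.1, Set.mem_iInter.1 hw k⟩) fun k l h => ?_⟩
  simpa [Subtype.ext_iff] using h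

variable [MeasurableSpace E] [BorelSpace E]

/-- It is unlikely that in some direction of `extremeDual E` as many as `29 K / 60` of the clean block
means lie above their expectation by more than `3 R √(K / N)`. -/
lemma measure_exists_blockMean_gt_le [Nontrivial E] {N K : ℕ} {B : Fin K → Finset (Fin N)}
    (hK : 1 ≤ K) (hKN : K ≤ N) (hB : IsBlocks B) {Ω : Type*} [MeasurableSpace Ω] {P : Measure Ω}
    [IsProbabilityMeasure P] {ν : Measure E} [IsProbabilityMeasure ν] {Y : Fin N → Ω → E}
    (hν : MemLp (fun y : E => y) 2 ν) (hY : iIndepFun Y P) (hlaw : ∀ i, HasLaw (Y i) ν P)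
    (hVC : 24000 * (dualVC E : ℝ) ≤ K) :
    P {ω | ∃ v ∈ extremeDual E, 29 / 60 * (K : ℝ) ≤ Nat.card {k //
      3 * weakStd ν * √((K : ℝ) / N) < v (blockMean B (fun i => Y i ω) k) - v (∫ z, z ∂ν)}} ≤
      ENNReal.ofReal (Real.exp (-(K : ℝ) / 128)) := by
  set m := ∫ z, z ∂ν with hm
  set t := 3 * weakStd ν * √((K : ℝ) / N) with ht
  set n := N / K with hn
  have hR : 0 ≤ weakStd ν := Real.sqrt_nonneg _
  have ht0 : 0 ≤ t := by positivity
  have hn1 : 1 ≤ n := (Nat.one_le_div_iff hK).2 hKN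
  have : Nonempty (Fin n) := ⟨⟨0, hn1⟩⟩
  have : Nonempty (Fin K) := ⟨⟨0, hK⟩⟩
  have hK0 : (0 : ℝ) < K := by exact_mod_cast hK
  have hN0 : (0 : ℝ) < N := by exact_mod_cast hK.trans hKN
  have hV1 : (1 : ℝ) ≤ dualVC E := by exact_mod_cast one_le_dualVC (E := E)
  obtain ⟨e, he, hesum⟩ := exists_block_enumeration hB.1 hB.2
  obtain ⟨D, hDc, hDsub, hD⟩ := exists_countable_extremeDual E
  have : Countable D := hDc
  set ρ := Measure.pi fun _ : Fin n => ν with hρ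
  set f : (Fin n → E) → E := fun u => (n : ℝ)⁻¹ • ∑ j, u j - m with hf
  have hfv : ∀ (v : StrongDual ℝ E) u, v (f u) = (n : ℝ)⁻¹ * ∑ j, v (u j) - v m := by
    intro v u; simp [hf]
  set A : D → Set (Fin n → E) := fun v => {u | t < v.1 (f u)} with hA
  have hAm : ∀ v, MeasurableSet (A v) := by
    intro v
    refine measurableSet_lt measurable_const ?_
    simp_rw [hfv]
    refine Measurable.sub_const (Measurable.const_mul ?_ _) _
    exact Finset.measurable_sum _ fun j _ =>
      v.1.continuous.measurable.comp (measurable_pi_apply j)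
  -- `⌊N / K⌋ > N / (2 * K)`
  have hnK : (N : ℝ) ≤ 2 * n * K := by
    have h1 : N < n * K + K := Nat.lt_div_mul_add hK
    have h2 : K ≤ n * K := Nat.le_mul_of_pos_left K hn1
    have h3 : N ≤ 2 * n * K := by nlinarith
    exact_mod_cast h3
  have hvar : weakStd ν ^ 2 ≤ 2 / 9 * (n : ℝ) * t ^ 2 := by
    rw [ht, mul_pow, mul_pow, Real.sq_sqrt (by positivity)]
    have h1 : 1 ≤ 2 * n * K / (N : ℝ) := (one_le_div hN0).2 hnK
    calc weakStd ν ^ 2 ≤ weakStd ν ^ 2 * (2 * n * K / (N : ℝ)) :=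
          le_mul_of_one_le_right (sq_nonneg _) h1
      _ = _ := by ring
  have hAρ : ∀ v, 3 * ρ.real (A v) ≤ 2 * (1 / 3) := by
    intro v
    have hL : MemLp v.1 2 ν := v.1.comp_memLp' hν
    have h := pi_mean_tail_le (ι := Fin n) ν hL (p := 2 / 9) ht0 (by norm_num)
      (by rw [Fintype.card_fin]; exact (variance_le_weakStd_sq hν (hDsub v.2)).trans hvar)
    rw [integral_dual_apply hν, Fintype.card_fin] at h
    have hAeq : A v = {u | t < (n : ℝ)⁻¹ * ∑ j, v.1 (u j) - v.1 m} := by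
      ext u; rw [hA, Set.mem_ofPred_eq, hfv]; rfl
    rw [hAeq]
    linarith
  -- `1 / 3 + 3 / 20 = 29 / 60` stays below `1 / 2`, and the excess `3 / 20` gives the rate
  -- `(3 / 20) ^ 2 / 2 = 9 / 800 > 1 / 128`
  have hvc := pi_exists_count_ge_le (ι := Fin K) ρ hAm (b := 1 / 3) (u := 3 / 20)
    (by norm_num) (by norm_num) hAρ
    (fun x => card_traces_le (fun v : D => v.1) (fun v => hDsub v.2) f t x)
  simp only [Fintype.card_prod, Fintype.card_fin, Fintype.card_bool] at hvc
  set T : Ω → Fin K → Fin n → E := fun ω k j => Y (e (k, j)) ω with hT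
  have hTm : AEMeasurable T P := by
    refine aemeasurable_pi_lambda _ fun k => aemeasurable_pi_lambda _ fun j => ?_
    exact (hlaw _).aemeasurable
  have hTmap : P.map T = Measure.pi fun _ : Fin K => ρ := map_blocks_eq_pi hY hlaw he
  rw [← hTmap, Measure.map_apply_of_aemeasurable hTm (by
    rw [show {z : Fin K → Fin n → E | ∃ v, (1 / 3 + 3 / 20) * (K : ℝ) ≤
      Nat.card {i // z i ∈ A v}} = ⋃ v, {z | (1 / 3 + 3 / 20) * (K : ℝ) ≤
        Nat.card {i // z i ∈ A v}} by ext; simp]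
    exact .iUnion fun v => measurableSet_le measurable_const (measurable_natCard_mem (hAm v)))]
    at hvc
  refine (measure_mono ?_).trans (hvc.trans (ENNReal.ofReal_le_ofReal ?_))
  · rintro ω ⟨v, hv, hvω⟩
    have hblock : ∀ (w : StrongDual ℝ E) k,
        w (blockMean B (fun i => Y i ω) k) - w m = w (f (T ω k)) := by
      intro w k
      rw [← map_sub, blockMean, hB.2 k, hesum]
    simp_rw [hblock] at hvω
    obtain ⟨w, hw, hle⟩ := hD K (fun k => f (T ω k)) t v hv
    refine ⟨⟨w, hw⟩, ?_⟩
    have h1 : (1 / 3 + 3 / 20 : ℝ) * K = 29 / 60 * K := by ring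
    rw [h1]
    exact hvω.trans (by exact_mod_cast hle)
  · -- `2 ≤ K / 1000`, `24 * dualVC E ≤ K / 1000` and `9 / 800 - 3 / 1000 > 1 / 128`
    have h3 : (3 : ℝ) ≤ Real.exp 2 := by linarith [Real.add_one_le_exp (2 : ℝ)]
    calc 3 * (Real.exp (24 * dualVC E + ((K * 2 : ℕ) : ℝ) / 2000) *
          Real.exp (-((3 / 20) ^ 2 * (K : ℝ) / 2)))
        ≤ Real.exp 2 * (Real.exp (24 * dualVC E + ((K * 2 : ℕ) : ℝ) / 2000) *
          Real.exp (-((3 / 20) ^ 2 * (K : ℝ) / 2))) := by gcongr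
      _ ≤ Real.exp (-(K : ℝ) / 128) := by
          rw [← Real.exp_add, ← Real.exp_add, Real.exp_le_exp]
          push_cast
          linarith

end Uniform

/-! ### The estimator -/

section Estimator

variable {E : Type*} [NormedAddCommGroup E] [NormedSpace ℝ E] [FiniteDimensional ℝ E]
  [MeasurableSpace E] [BorelSpace E]

/-- The bound for a given number of blocks, with the constant `24000`. -/
lemma measure_not_momSet_le {N K : ℕ} {B : Fin K → Finset (Fin N)} (hK : 1 ≤ K) (hKN : K ≤ N)
    (hB : IsBlocks B) {Ω : Type*} [MeasurableSpace Ω] {P : Measure Ω} [IsProbabilityMeasure P]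
    {ν : Measure E} [IsProbabilityMeasure ν] {Y X : Fin N → Ω → E} {O : Ω → Finset (Fin N)}
    (h : ContaminatedSample P ν Y X O)
    (hC : ∀ᵐ ω ∂P, 24000 * max (dualVC E : ℝ) ((O ω).card : ℝ) ≤ K) :
    P {ω | ¬ ((momSet B (4 * weakStd ν * √((K : ℝ) / N)) (fun i => X i ω)).Nonempty ∧
        ∀ y ∈ momSet B (4 * weakStd ν * √((K : ℝ) / N)) (fun i => X i ω),
          ‖y - ∫ z, z ∂ν‖ ≤ 8 * weakStd ν * √((K : ℝ) / N) ∧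
          (0 < weakStd ν → ‖y - ∫ z, z ∂ν‖ < 8 * weakStd ν * √((K : ℝ) / N)))}
      ≤ ENNReal.ofReal (Real.exp (-(K : ℝ) / 128)) := by
  set m := ∫ z, z ∂ν with hm
  have hR : 0 ≤ weakStd ν := Real.sqrt_nonneg _
  have hK0 : (0 : ℝ) < K := by exact_mod_cast hK
  have hN0 : (0 : ℝ) < N := by exact_mod_cast hK.trans hKN
  have hs : 0 < √((K : ℝ) / N) := Real.sqrt_pos.2 (by positivity)
  have hRs : 0 ≤ weakStd ν * √((K : ℝ) / N) := by positivity
  -- the conclusion holds once all medians are within three quarters of the radius of `v m`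
  have hdet : ∀ x : Fin N → E, (∀ v ∈ extremeDual E,
      |med (fun k => v (blockMean B x k)) - v m| ≤ 3 * weakStd ν * √((K : ℝ) / N)) →
      (momSet B (4 * weakStd ν * √((K : ℝ) / N)) x).Nonempty ∧
        ∀ y ∈ momSet B (4 * weakStd ν * √((K : ℝ) / N)) x,
          ‖y - m‖ ≤ 8 * weakStd ν * √((K : ℝ) / N) ∧
          (0 < weakStd ν → ‖y - m‖ < 8 * weakStd ν * √((K : ℝ) / N)) := by
    intro x hx
    refine ⟨⟨m, Set.mem_iInter₂.2 fun v hv => (hx v hv).trans (by linarith)⟩, fun y hy => ?_⟩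
    have := norm_sub_le_of_mem_momSet hy hx
    exact ⟨by linarith, fun hpos => by linarith [mul_pos hpos hs]⟩
  rcases subsingleton_or_nontrivial E with hE | hE
  · -- in the trivial space all functionals vanish
    have h0 : ∀ (v : StrongDual ℝ E) y, v y = 0 := fun v y => by
      rw [Subsingleton.elim y 0, map_zero]
    refine le_of_eq_of_le (measure_mono_null (fun ω hω => ?_) measure_empty) bot_le
    refine hω (hdet _ fun v hv => ?_)
    obtain ⟨i, hi, -⟩ := exists_med_eq hK fun k => v (blockMean B (fun i => X i ω) k)
    rw [hi, h0, h0, sub_zero, abs_zero]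
    linarith
  · by_cases hVC : 24000 * (dualVC E : ℝ) ≤ K
    · refine (measure_mono_ae ?_).trans
        (measure_exists_blockMean_gt_le hK hKN hB h.memLp h.indep h.law hVC)
      filter_upwards [hC, h.clean] with ω hω hclean hbad
      by_contra hgood
      refine hbad (hdet _ fun v hv => ?_)
      refine abs_med_sub_le hK hB.1 hclean (q := 29 / 60 * (K : ℝ)) m ?_ (fun w hw => ?_) hv
      · have := (mul_le_mul_of_nonneg_left (le_max_right (dualVC E : ℝ) ((O ω).card : ℝ))
          (by norm_num : (0 : ℝ) ≤ 24000)).trans hω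
        linarith
      · by_contra! hc
        exact hgood ⟨w, hw, hc⟩
    · exfalso
      obtain ⟨ω, hω⟩ := hC.exists
      exact hVC ((mul_le_mul_of_nonneg_left (le_max_left _ _) (by norm_num)).trans hω)

lemma sqrt_div_le_of_le {N V L ε k : ℝ} (hN : 0 < N) (hV : 0 ≤ V) (hL : 0 ≤ L) (hε : 0 ≤ ε)
    (hk : k ≤ 24000 * (V + ε * N) + 2 * L) :
    √(k / N) ≤ 160 * (√(V / N) + √(L / N) + √ε) := by
  have h1 : 0 ≤ √(V / N) := Real.sqrt_nonneg _
  have h2 : 0 ≤ √(L / N) := Real.sqrt_nonneg _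
  have h3 : 0 ≤ √ε := Real.sqrt_nonneg _
  refine Real.sqrt_le_iff.2 ⟨by positivity, ?_⟩
  have e1 := Real.sq_sqrt (div_nonneg hV hN.le)
  have e2 := Real.sq_sqrt (div_nonneg hL hN.le)
  have e3 := Real.sq_sqrt hε
  have h : k / N ≤ 24000 * (V / N + ε) + 2 * (L / N) := by
    rw [div_le_iff₀ hN]
    have : (24000 * (V / N + ε) + 2 * (L / N)) * N = 24000 * (V + ε * N) + 2 * L := by
      field_simp
    linarith
  have h4 : V / N + L / N + ε ≤ (√(V / N) + √(L / N) + √ε) ^ 2 := by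
    nlinarith [mul_nonneg h1 h2, mul_nonneg h1 h3, mul_nonneg h2 h3]
  have h5 : 0 ≤ V / N := div_nonneg hV hN.le
  have h6 : 0 ≤ L / N := div_nonneg hL hN.le
  nlinarith

end Estimator

theorem theorem3p1 :
    ∃ C A c : ℝ, 0 < C ∧ 0 < A ∧ 0 < c ∧
    ∀ (E : Type u) [NormedAddCommGroup E] [NormedSpace ℝ E] [FiniteDimensional ℝ E]
      [MeasurableSpace E] [BorelSpace E] (N : ℕ),
    -- the bound for a given number of blocks
    (∀ (K : ℕ) (B : Fin K → Finset (Fin N)), 1 ≤ K → K ≤ N → IsBlocks B →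
      ∀ (Ω : Type w) [MeasurableSpace Ω] (P : Measure Ω) [IsProbabilityMeasure P]
        (ν : Measure E) [IsProbabilityMeasure ν] (Y X : Fin N → Ω → E) (O : Ω → Finset (Fin N)),
        ContaminatedSample P ν Y X O →
        (∀ᵐ ω ∂P, C * max (dualVC E : ℝ) ((O ω).card : ℝ) ≤ K) →
        P {ω | ¬ ((momSet B (4 * weakStd ν * √((K : ℝ) / N)) (fun i => X i ω)).Nonempty ∧
            ∀ y ∈ momSet B (4 * weakStd ν * √((K : ℝ) / N)) (fun i => X i ω),
              ‖y - ∫ z, z ∂ν‖ ≤ 8 * weakStd ν * √((K : ℝ) / N) ∧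
              (0 < weakStd ν → ‖y - ∫ z, z ∂ν‖ < 8 * weakStd ν * √((K : ℝ) / N)))}
          ≤ ENNReal.ofReal (Real.exp (-(K : ℝ) / 128))) ∧
    -- the bound at a given confidence level; the number of blocks does not depend on the law
    (∀ δ ε : ℝ, Real.exp (-c * N) ≤ δ → δ ≤ 1 / 2 → 0 ≤ ε →
      C * max (dualVC E : ℝ) (⌊ε * N⌋₊ : ℝ) ≤ N →
      ∃ K : ℕ, 1 ≤ K ∧ K ≤ N ∧ ∀ B : Fin K → Finset (Fin N), IsBlocks B →
      ∀ (Ω : Type w) [MeasurableSpace Ω] (P : Measure Ω) [IsProbabilityMeasure P]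
        (ν : Measure E) [IsProbabilityMeasure ν] (Y X : Fin N → Ω → E) (O : Ω → Finset (Fin N)),
        ContaminatedSample P ν Y X O →
        (∀ᵐ ω ∂P, (O ω).card ≤ ⌊ε * N⌋₊) →
        P {ω | ¬ ((momSet B (4 * weakStd ν * √((K : ℝ) / N)) (fun i => X i ω)).Nonempty ∧
            ∀ y ∈ momSet B (4 * weakStd ν * √((K : ℝ) / N)) (fun i => X i ω),
              ‖y - ∫ z, z ∂ν‖ ≤ A * weakStd ν *
                (√((dualVC E : ℝ) / N) + √(128 * Real.log (1 / δ) / N) + √ε))}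
          ≤ ENNReal.ofReal δ) := by
  refine ⟨24000, 1280, 1 / 128, by norm_num, by norm_num, by norm_num, ?_⟩
  intro E _ _ _ _ _ N
  refine ⟨fun K B hK hKN hB Ω _ P _ ν _ Y X O h hC => measure_not_momSet_le hK hKN hB h hC, ?_⟩
  intro δ ε hδ hδ2 hε hN
  have hδ0 : 0 < δ := (Real.exp_pos _).trans_le hδ
  set L := 128 * Real.log (1 / δ) with hL
  have hlog : Real.log (1 / δ) = -Real.log δ := by rw [one_div, Real.log_inv]
  have hL1 : 1 ≤ L := by
    have h1 : Real.log 2 ≤ Real.log (1 / δ) :=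
      Real.log_le_log (by norm_num) (by rw [le_one_div (by norm_num) hδ0]; exact hδ2)
    linarith [Real.log_two_gt_d9]
  have hLN : L ≤ N := by
    have := (Real.le_log_iff_exp_le hδ0).2 hδ
    linarith
  have hN0 : (0 : ℝ) < N := by linarith
  set V := (dualVC E : ℝ) with hV
  have hV0 : 0 ≤ V := Nat.cast_nonneg _
  -- the least number of blocks allowed by the contamination, the dimension and the confidence level
  set k : ℝ := max (24000 * max V (⌊ε * N⌋₊ : ℝ)) L with hk
  have hkN : k ≤ N := max_le hN hLN
  have hkL : L ≤ k := le_max_right _ _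
  set K := ⌈k⌉₊ with hKdef
  have hKN : K ≤ N := Nat.ceil_le.2 hkN
  have hkK : k ≤ K := Nat.le_ceil k
  have hK : 1 ≤ K := by
    have : (1 : ℝ) ≤ K := by linarith
    exact_mod_cast this
  refine ⟨K, hK, hKN, fun B hB Ω _ P _ ν _ Y X O h hO => ?_⟩
  have hC : ∀ᵐ ω ∂P, 24000 * max (dualVC E : ℝ) ((O ω).card : ℝ) ≤ K := by
    filter_upwards [hO] with ω hω
    have h1 : ((O ω).card : ℝ) ≤ (⌊ε * N⌋₊ : ℝ) := by exact_mod_cast hω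
    calc 24000 * max (dualVC E : ℝ) ((O ω).card : ℝ) ≤ 24000 * max V (⌊ε * N⌋₊ : ℝ) := by gcongr
      _ ≤ k := le_max_left _ _
      _ ≤ K := hkK
  have hR : 0 ≤ weakStd ν := Real.sqrt_nonneg _
  have hKle : (K : ℝ) ≤ 24000 * (V + ε * N) + 2 * L := by
    -- `L ≥ 1`, as `δ ≤ 1 / 2`, absorbs the rounding error
    have h1 : (K : ℝ) < k + 1 := Nat.ceil_lt_add_one (by linarith)
    have h2 : (⌊ε * N⌋₊ : ℝ) ≤ ε * N := Nat.floor_le (by positivity)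
    have h3 : max V (⌊ε * N⌋₊ : ℝ) ≤ V + ε * N :=
      max_le (le_add_of_nonneg_right (by positivity)) (by linarith)
    have h4 : k ≤ 24000 * (V + ε * N) + L :=
      max_le (by linarith) (le_add_of_nonneg_left (by positivity))
    linarith
  have hsqrt := sqrt_div_le_of_le hN0 hV0 (by linarith : 0 ≤ L) hε hKle
  refine (measure_mono ?_).trans
    ((measure_not_momSet_le hK hKN hB h hC).trans (ENNReal.ofReal_le_ofReal ?_))
  · intro ω hω hgood
    refine hω ⟨hgood.1, fun y hy => ?_⟩
    refine ((hgood.2 y hy).1).trans ?_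
    have := mul_le_mul_of_nonneg_left hsqrt (by positivity : 0 ≤ 8 * weakStd ν)
    refine this.trans (le_of_eq ?_)
    ring
  · rw [← Real.le_log_iff_exp_le hδ0]
    linarith
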